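/- For integers $1\le r\le s\le n$, let $\tilde\Sigma_{s,r}$ be the set of matrices $X\in\mathbb R^{n\times n}$ with Frobenius norm $\|X\|_F=1$ and rank at most $r$ for which there are index sets $S,T\subseteq\{1,\dots,n\}$ with $|S|=|T|=s$ such that $X_{ij}=0$ whenever $i\notin S$ or $j\notin T$. For a linear map $\mathcal A:\mathbb R^{n\times n}\to\mathbb R^m$, let $\operatorname{sgn}\mathcal A(X)\in\{\pm1\}^m$ be the vector of signs of the entries of $\mathcal A(X)$, with the convention $\operatorname{sgn}(0)=1$. The $m$-th consistency width of a set $\mathcal K$ of unit-norm matrices is $$\mathrm{CW}^m(\mathcal K)=\inf_{\mathcal A:\mathbb R^{n\times n}\to\mathbb R^m\ \text{linear}}\ \sup\{\|X-X'\|_F:\ X,X'\in\mathcal K,\ \operatorname{sgn}\mathcal A(X)=\operatorname{sgn}\mathcal A(X')\}.$$ A Gaussian random map is $\mathcal A(X)=(\operatorname{tr}(A_i^\top X))_{i=1}^m$, where all the entries of $A_1,\dots,A_m\in\mathbb R^{n\times n}$ are independent standard Gaussian random variables. (i) There are absolute constants $C,c>0$ such that the following holds for all integers $1\le r\le s\le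 n$ and $m\ge 0$, and all real $\varepsilon>0$ with $n/(\varepsilon s)\ge 2$. If $$m\ \ge\ \frac{C}{\varepsilon}\,rs\,\ln\Big(\frac{n}{\varepsilon s}\Big),$$ and if $\mathcal A:\mathbb R^{n\times n}\to\mathbb R^m$ is a Gaussian random map, then with probability at least $1-\exp(-c\varepsilon m)$ one has, for all $X,X'\in\tilde\Sigma_{s,r}$, $$\operatorname{sgn}\mathcal A(X)=\operatorname{sgn}\mathcal A(X')\ \Longrightarrow\ \|X-X'\|_F\le\varepsilon .$$ (ii) There is an absolute constant $C>0$ such that, for all integers $1\le r\le s\le n$ and $m\ge 0$ with $nm/(rs)\ge 2$, $$\mathrm{CW}^m(\tilde\Sigma_{s,r})\ \le\ C\,\frac{rs}{m}\,\ln\Big(\frac{nm}{rs}\Big).$$ -/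

import Mathlib

-- Matrices carry the Frobenius norm, so that `‖X‖` is the Frobenius norm of `X`.
attribute [local instance] Matrix.frobeniusNormedAddCommGroup

namespace OneBit

/-- The matrices of rank at most `r` supported on `S × T` for some index sets with
`|S| = |T| = s`. -/
def bisparseLowRank (n s r : ℕ) : Set (Matrix (Fin n) (Fin n) ℝ) :=
  {X | X.rank ≤ r ∧ ∃ S T : Finset (Fin n), S.card = s ∧ T.card = s ∧
    (∀ i j, i ∉ S → X i j = 0) ∧ (∀ i j, j ∉ T → X i j = 0)}

/-- The elements of `bisparseLowRank n s r` with unit Frobenius norm. -/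
def unitBisparseLowRank (n s r : ℕ) : Set (Matrix (Fin n) (Fin n) ℝ) :=
  bisparseLowRank n s r ∩ {X | ‖X‖ = 1}

/-- The sign with values in `{-1, 1}`, where `sgn 0 = 1`. -/
noncomputable def sgn (x : ℝ) : ℝ := if 0 ≤ x then 1 else -1

/-- The linear map `M ↦ (⟨A i, M⟩)ᵢ`, where `⟨A, M⟩ = tr (Aᵀ M)` is the Frobenius inner
product. -/
def measurementMap {n m : ℕ} (A : Fin m → Matrix (Fin n) (Fin n) ℝ) :
    Matrix (Fin n) (Fin n) ℝ →ₗ[ℝ] (Fin m → ℝ) where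
  toFun M := fun i => ((A i).transpose * M).trace
  map_add' M N := by
    funext i
    simp [Matrix.mul_add]
  map_smul' a M := by
    funext i
    simp

/-- The one-bit measurements `sgn (𝒜 X)`, the sign being taken entrywise. -/
noncomputable def oneBit {n m : ℕ} (𝒜 : Matrix (Fin n) (Fin n) ℝ →ₗ[ℝ] (Fin m → ℝ))
    (X : Matrix (Fin n) (Fin n) ℝ) : Fin m → ℝ :=
  fun i => sgn (𝒜 X i)

/-- The `m`-th consistency width of `K`: the infimum over all linear maps `𝒜` into `ℝᵐ` of the
supremum of the Frobenius distances between elements of `K` having the same one-bit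
measurements. -/
noncomputable def consistencyWidth {n : ℕ} (m : ℕ) (K : Set (Matrix (Fin n) (Fin n) ℝ)) :
    ENNReal :=
  ⨅ 𝒜 : Matrix (Fin n) (Fin n) ℝ →ₗ[ℝ] (Fin m → ℝ),
    ⨆ (X ∈ K) (X' ∈ K) (_ : oneBit 𝒜 X = oneBit 𝒜 X'), ENNReal.ofReal ‖X - X'‖

/-- All entries of the random matrices `A 1, …, A m` are jointly independent standard Gaussian
random variables. -/
def IsGaussianFamily {Ω : Type*} [MeasurableSpace Ω] (P : MeasureTheory.Measure Ω) {n m : ℕ}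
    (A : Fin m → Ω → Matrix (Fin n) (Fin n) ℝ) : Prop :=
  ProbabilityTheory.iIndepFun
      (fun (p : Fin m × Fin n × Fin n) (ω : Ω) => A p.1 ω p.2.1 p.2.2) P ∧
    ∀ i k l, ProbabilityTheory.HasLaw (fun ω => A i ω k l)
      (ProbabilityTheory.gaussianReal 0 1) P

end OneBit

/-! Suppose two unit points X, X' of the set K of bisparse low-rank matrices have equal signs but
distance more than ε, and approximate them by net points p, q in K, which are then at distance at
least ε/2. A Gaussian hyperplane separates p from q with margin ε/16 with probability at least a
constant times ε (`le_measure_separating`). By a Chernoff bound and a union bound over pairs of net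
points, order εm of the m hyperplanes do this, for all such pairs at once. At each of them the
common sign of X and X' forces a measurement of X - p or X' - q to be at least ε/16 in absolute
value, so the squares of these measurements add up to order ε³m (`norm_sub_le_of_separating`).

They are in fact uniformly smaller. K is covered by (n choose s)² images of products of balls, of
total dimension 2rs, under bilinear maps Φ (`exists_eq_rowMatrix`). If the parameters of X and p are
ρ-close, telescoping bounds the measurements of X - p by 2ρ times the norm of the bilinear map L ∘
Φ, where L is the measurement map. This norm is controlled by finitely many test vectors
(`exists_net_of_bilinear`), and each test vector has measurements of norm at most √(8m) outside an
event of probability exp(-m).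

The choice of ρ proportional to ε² suffices and costs only a factor of order log(1/ε) in the
log-cardinality of the nets, which log(n/(εs)) absorbs. All union bounds together cost exp(O(rs
log(n/(εs)))), which is beaten once εm is a large multiple of that exponent. For (ii), ε is taken of
order (rs/m) log(nm/(rs)), and a good event of positive probability supplies the linear map. -/

namespace OneBit

open MeasureTheory Module Metric

/-! ### Nets of balls and of their images under bilinear maps -/

open scoped Function ENNReal in
/-- A `ρ`-separated subset of the unit ball has at most `(1 + 2 / ρ) ^ dim` elements. -/
theorem card_le_of_separated_of_norm_le_one {E : Type*} [NormedAddCommGroup E] [NormedSpace ℝ E]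
    [FiniteDimensional ℝ E] {ρ : ℝ} (hρ : 0 < ρ) (s : Finset E) (hs : ∀ c ∈ s, ‖c‖ ≤ 1)
    (h : ∀ c ∈ s, ∀ d ∈ s, c ≠ d → ρ ≤ ‖c - d‖) :
    (s.card : ℝ) ≤ (1 + 2 / ρ) ^ finrank ℝ E := by
  borelize E
  let μ : Measure E := Measure.addHaar
  have hR : 0 < 1 + ρ / 2 := by positivity
  have hδ : 0 < ρ / 2 := by positivity
  have D : Set.Pairwise (s : Set E) (Disjoint on fun c => ball (c : E) (ρ / 2)) := by
    rintro c hc d hd hcd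
    apply ball_disjoint_ball
    rw [dist_eq_norm]
    linarith [h c hc d hd hcd]
  have hsub : (⋃ c ∈ s, ball (c : E) (ρ / 2)) ⊆ ball (0 : E) (1 + ρ / 2) := by
    refine Set.iUnion₂_subset fun x hx => ball_subset_ball' ?_
    rw [dist_zero_right]
    linarith [hs x hx]
  have I : (s.card : ℝ≥0∞) * ENNReal.ofReal ((ρ / 2) ^ finrank ℝ E) * μ (ball 0 1) ≤
      ENNReal.ofReal ((1 + ρ / 2) ^ finrank ℝ E) * μ (ball 0 1) :=
    calc
      _ = μ (⋃ c ∈ s, ball (c : E) (ρ / 2)) := by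
        rw [measure_biUnion_finset D fun c _ => measurableSet_ball]
        simp only [μ.addHaar_ball_of_pos _ hδ, Finset.sum_const, nsmul_eq_mul, mul_assoc]
      _ ≤ μ (ball (0 : E) (1 + ρ / 2)) := measure_mono hsub
      _ = _ := by simp only [μ.addHaar_ball_of_pos _ hR]
  have J := (ENNReal.mul_le_mul_iff_left (measure_ball_pos _ _ zero_lt_one).ne'
    measure_ball_lt_top.ne).1 I
  have K : (s.card : ℝ) * (ρ / 2) ^ finrank ℝ E ≤ (1 + ρ / 2) ^ finrank ℝ E := by
    have := ENNReal.toReal_le_of_le_ofReal (pow_nonneg hR.le _) J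
    rwa [ENNReal.toReal_mul, ENNReal.toReal_natCast, ENNReal.toReal_ofReal (by positivity)] at this
  rw [← le_div_iff₀ (by positivity), ← div_pow] at K
  have e : (1 + ρ / 2) / (ρ / 2) = 1 + 2 / ρ := by field_simp; ring
  rwa [e] at K

/-- A ρ-separated subset of `A` of largest cardinality is a ρ-net, and the volume bound makes this
maximum exist. The net stays inside `A`, so that the approximating matrices will again be unit
vectors of K. -/
theorem exists_finset_net {E : Type*} [NormedAddCommGroup E] [NormedSpace ℝ E]
    [FiniteDimensional ℝ E] {ρ : ℝ} (hρ : 0 < ρ) (A : Set E) (hA : ∀ x ∈ A, ‖x‖ ≤ 1) :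
    ∃ N : Finset E, (N : Set E) ⊆ A ∧ (N.card : ℝ) ≤ (1 + 2 / ρ) ^ finrank ℝ E ∧
      ∀ x ∈ A, ∃ y ∈ N, ‖x - y‖ ≤ ρ := by
  classical
  let Q : ℕ → Prop := fun k => ∃ N : Finset E, (N : Set E) ⊆ A ∧
    (∀ c ∈ N, ∀ d ∈ N, c ≠ d → ρ ≤ ‖c - d‖) ∧ N.card = k
  have hb : ∀ k, Q k → k ≤ ⌊(1 + 2 / ρ) ^ finrank ℝ E⌋₊ := by
    rintro k ⟨N, hN, hsep, rfl⟩
    exact Nat.le_floor (card_le_of_separated_of_norm_le_one hρ N (fun c hc => hA c (hN hc)) hsep)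
  have h0 : Q 0 := ⟨∅, by simp, by simp, by simp⟩
  obtain ⟨N, hN, hsep, hcard⟩ := Nat.findGreatest_spec (P := Q) (Nat.zero_le _) h0
  refine ⟨N, hN, card_le_of_separated_of_norm_le_one hρ N (fun c hc => hA c (hN hc)) hsep, ?_⟩
  intro x hx
  by_contra! hcon
  have hxN : x ∉ N := fun hmem => by
    have := hcon x hmem
    simp only [sub_self, norm_zero] at this
    exact absurd this hρ.not_gt
  have hQ : Q (N.card + 1) := by
    refine ⟨insert x N, ?_, ?_, Finset.card_insert_of_notMem hxN⟩
    · rw [Finset.coe_insert]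
      exact Set.insert_subset hx hN
    · intro c hc d hd hcd
      rw [Finset.mem_insert] at hc hd
      rcases hc with rfl | hc <;> rcases hd with rfl | hd
      · exact absurd rfl hcd
      · exact (hcon d hd).le
      · rw [norm_sub_rev]; exact (hcon c hc).le
      · exact hsep c hc d hd hcd
  have := Nat.le_findGreatest (hb _ hQ) hQ
  rw [← hcard] at this
  omega

/-- If a bilinear map is bounded by `b` on `1 / 4`-nets of the unit balls, then it is bounded by
`2 * b` on the unit balls. -/
theorem opNorm_le_of_net {E₁ E₂ F : Type*} [NormedAddCommGroup E₁] [NormedSpace ℝ E₁]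
    [NormedAddCommGroup E₂] [NormedSpace ℝ E₂] [NormedAddCommGroup F] [NormedSpace ℝ F]
    (L : E₁ →L[ℝ] E₂ →L[ℝ] F) (N : Set (E₁ × E₂)) (hN : ∀ w ∈ N, ‖w‖ ≤ 1)
    (hnet : ∀ w : E₁ × E₂, ‖w‖ ≤ 1 → ∃ w' ∈ N, ‖w - w'‖ ≤ 1 / 4)
    {b : ℝ} (hb : ∀ w ∈ N, ‖L w.1 w.2‖ ≤ b) : ‖L‖ ≤ 2 * b := by
  have hb0 : 0 ≤ b := by
    obtain ⟨w', hw', -⟩ := hnet 0 (by simp)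
    exact (norm_nonneg _).trans (hb w' hw')
  have key : ∀ u v, ‖u‖ = 1 → ‖v‖ = 1 → ‖L u v‖ ≤ b + ‖L‖ / 2 := by
    intro u v hu hv
    obtain ⟨⟨u', v'⟩, hw', hd⟩ := hnet (u, v) (by simp [Prod.norm_def, hu, hv])
    have h1 := hN _ hw'
    simp only [Prod.norm_def, Prod.mk_sub_mk, sup_le_iff] at hd h1
    have e : L u v = L u' v' + (L (u - u') v + L u' (v - v')) := by
      simp only [map_sub, sub_apply]; abel
    have h2 : ‖L (u - u') v‖ ≤ ‖L‖ * (1 / 4) * 1 :=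
      (L.le_opNorm₂ _ _).trans (by rw [hv]; gcongr; exact hd.1)
    have h3 : ‖L u' (v - v')‖ ≤ ‖L‖ * 1 * (1 / 4) :=
      (L.le_opNorm₂ _ _).trans (by gcongr; exacts [h1.1, hd.2])
    have h4 := hb _ hw'
    rw [e]
    refine (norm_add_le _ _).trans ?_
    have := norm_add_le (L (u - u') v) (L u' (v - v'))
    dsimp only at h4
    linarith
  -- Replacing each of the two arguments by a net point costs `‖L‖ / 4`, so the error can be
  -- absorbed on the left.
  have : ‖L‖ ≤ b + ‖L‖ / 2 := by
    have h0 : 0 ≤ b + ‖L‖ / 2 := by positivity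
    refine ContinuousLinearMap.opNorm_le_of_unit_norm h0 fun u hu => ?_
    exact ContinuousLinearMap.opNorm_le_of_unit_norm h0 fun v hv => key u v hu hv
  linarith

theorem norm_bilinear_sub_le {E₁ E₂ F : Type*} [NormedAddCommGroup E₁] [NormedSpace ℝ E₁]
    [NormedAddCommGroup E₂] [NormedSpace ℝ E₂] [NormedAddCommGroup F] [NormedSpace ℝ F]
    (L : E₁ →L[ℝ] E₂ →L[ℝ] F) {u u' : E₁} {v v' : E₂} {ρ : ℝ} (hu' : ‖u'‖ ≤ 1) (hv : ‖v‖ ≤ 1)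
    (hu : ‖u - u'‖ ≤ ρ) (hv' : ‖v - v'‖ ≤ ρ) : ‖L u v - L u' v'‖ ≤ 2 * ρ * ‖L‖ := by
  have hρ : 0 ≤ ρ := (norm_nonneg _).trans hu
  have e : L u v - L u' v' = L (u - u') v + L u' (v - v') := by
    simp only [map_sub, sub_apply]; abel
  have h2 : ‖L (u - u') v‖ ≤ ‖L‖ * ρ * 1 := (L.le_opNorm₂ _ _).trans (by gcongr)
  have h3 : ‖L u' (v - v')‖ ≤ ‖L‖ * 1 * ρ := (L.le_opNorm₂ _ _).trans (by gcongr)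
  rw [e]
  linarith [norm_add_le (L (u - u') v) (L u' (v - v'))]

/-- The previous two estimates apply to `L ∘ Φ`: the test set `R` does not depend on `L`, so a
single finite set of conditions on a random `L` controls all differences at once. -/
theorem norm_map_bilinear_sub_le {E₁ E₂ M F : Type*} [NormedAddCommGroup E₁] [NormedSpace ℝ E₁]
    [NormedAddCommGroup E₂] [NormedSpace ℝ E₂] [NormedAddCommGroup M] [NormedSpace ℝ M]
    [NormedAddCommGroup F] [NormedSpace ℝ F]
    (Φ : E₁ →L[ℝ] E₂ →L[ℝ] M) (L : M →L[ℝ] F) (R : Finset (E₁ × E₂)) (hRs : ∀ w ∈ R, ‖w‖ ≤ 1)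
    (hR : ∀ w : E₁ × E₂, ‖w‖ ≤ 1 → ∃ w' ∈ R, ‖w - w'‖ ≤ 1 / 4)
    {b : ℝ} (hb : ∀ w ∈ R, ‖L (Φ w.1 w.2)‖ ≤ b)
    {u u' : E₁} {v v' : E₂} {ρ : ℝ} (hu' : ‖u'‖ ≤ 1) (hv : ‖v‖ ≤ 1)
    (hu : ‖u - u'‖ ≤ ρ) (hv' : ‖v - v'‖ ≤ ρ) : ‖L (Φ u v - Φ u' v')‖ ≤ 4 * ρ * b := by
  have hρ : 0 ≤ ρ := (norm_nonneg _).trans hu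
  let B : E₁ →L[ℝ] E₂ →L[ℝ] F := (ContinuousLinearMap.compL ℝ E₂ M F L).comp Φ
  have hB : ∀ u v, B u v = L (Φ u v) := fun u v => rfl
  have hL : ‖B‖ ≤ 2 * b := opNorm_le_of_net B R hRs hR fun w hw => by rw [hB]; exact hb w hw
  have := norm_bilinear_sub_le B hu' hv hu hv'
  rw [hB, hB] at this
  rw [map_sub]
  refine this.trans ?_
  nlinarith

/-- The points of `K` in the image of the unit balls under a bilinear map have a net `N` in `K`,
together with a finite set `R` of test vectors which controls linear maps on the differences
between these points and their approximations. -/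
theorem exists_net_of_bilinear {E₁ E₂ M : Type*} [NormedAddCommGroup E₁] [NormedSpace ℝ E₁]
    [FiniteDimensional ℝ E₁] [NormedAddCommGroup E₂] [NormedSpace ℝ E₂] [FiniteDimensional ℝ E₂]
    [NormedAddCommGroup M] [NormedSpace ℝ M] (Φ : E₁ →L[ℝ] E₂ →L[ℝ] M) (hΦ : ‖Φ‖ ≤ 1)
    (K : Set M) {ρ : ℝ} (hρ : 0 < ρ) :
    ∃ N R : Finset M, (N : Set M) ⊆ K ∧
      (N.card : ℝ) ≤ (1 + 2 / ρ) ^ (finrank ℝ E₁ + finrank ℝ E₂) ∧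
      (R.card : ℝ) ≤ 9 ^ (finrank ℝ E₁ + finrank ℝ E₂) ∧ (∀ z ∈ R, ‖z‖ ≤ 1) ∧
      ∀ u v, ‖u‖ ≤ 1 → ‖v‖ ≤ 1 → Φ u v ∈ K → ∃ p ∈ N, ‖Φ u v - p‖ ≤ 2 * ρ ∧
        ∀ (m : ℕ) (L : M →L[ℝ] EuclideanSpace ℝ (Fin m)) (b : ℝ), (∀ z ∈ R, ‖L z‖ ≤ b) →
          ‖L (Φ u v - p)‖ ≤ 4 * ρ * b := by
  classical
  obtain ⟨N, hNs, hNc, hN⟩ := exists_finset_net hρ {w : E₁ × E₂ | ‖w‖ ≤ 1 ∧ Φ w.1 w.2 ∈ K}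
    (fun w hw => hw.1)
  obtain ⟨R, hRs, hRc, hR⟩ := exists_finset_net (E := E₁ × E₂) (ρ := 1 / 4) (by norm_num)
    {w | ‖w‖ ≤ 1} (fun w hw => hw)
  rw [finrank_prod] at hNc hRc
  replace hNs : ∀ w ∈ N, ‖w‖ ≤ 1 ∧ Φ w.1 w.2 ∈ K := fun w hw => hNs hw
  replace hRs : ∀ w ∈ R, ‖w‖ ≤ 1 := fun w hw => hRs hw
  replace hN : ∀ w : E₁ × E₂, ‖w‖ ≤ 1 → Φ w.1 w.2 ∈ K → ∃ w' ∈ N, ‖w - w'‖ ≤ ρ :=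
    fun w h h' => hN w ⟨h, h'⟩
  replace hR : ∀ w : E₁ × E₂, ‖w‖ ≤ 1 → ∃ w' ∈ R, ‖w - w'‖ ≤ 1 / 4 := hR
  rw [show (1 + 2 / (1 / 4) : ℝ) = 9 by norm_num] at hRc
  generalize hd : finrank ℝ E₁ + finrank ℝ E₂ = d at hNc hRc ⊢
  have image_card : ∀ T : Finset (E₁ × E₂), ((T.image fun w => Φ w.1 w.2).card : ℝ) ≤ T.card :=
    fun T => by exact_mod_cast Finset.card_image_le
  refine ⟨N.image fun w => Φ w.1 w.2, R.image fun w => Φ w.1 w.2, ?_, ?_, ?_, ?_, ?_⟩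
  · intro p hp
    obtain ⟨w, hw, rfl⟩ := Finset.mem_image.1 (Finset.mem_coe.1 hp)
    exact (hNs w hw).2
  · exact (image_card N).trans hNc
  · exact (image_card R).trans hRc
  · intro z hz
    obtain ⟨w, hw, rfl⟩ := Finset.mem_image.1 hz
    have hw1 : ‖w‖ ≤ 1 := hRs w hw
    rw [Prod.norm_def, sup_le_iff] at hw1
    calc ‖Φ w.1 w.2‖ ≤ ‖Φ‖ * ‖w.1‖ * ‖w.2‖ := Φ.le_opNorm₂ _ _
      _ ≤ 1 * 1 * 1 := by gcongr; exacts [hw1.1, hw1.2]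
      _ = 1 := by norm_num
  · intro u v hu hv huv
    obtain ⟨⟨u', v'⟩, hw', hd⟩ := hN (u, v) (by simp [Prod.norm_def, hu, hv]) huv
    have h1 : ‖(u', v')‖ ≤ 1 := (hNs _ hw').1
    simp only [Prod.norm_def, Prod.mk_sub_mk, sup_le_iff] at hd h1
    have hu' := h1.1
    refine ⟨Φ u' v', Finset.mem_image.2 ⟨_, hw', rfl⟩, ?_⟩
    refine ⟨(norm_bilinear_sub_le Φ hu' hv hd.1 hd.2).trans
      (mul_le_of_le_one_right (by positivity) hΦ), ?_⟩
    intro m L b hb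
    exact norm_map_bilinear_sub_le Φ L R hRs hR
      (fun w hw => hb _ (Finset.mem_image.2 ⟨w, hw, rfl⟩)) hu' hv hd.1 hd.2

/-! ### Bisparse low-rank matrices as bilinear images -/

/-- The vector of the entries of a matrix. -/
noncomputable def toVec {n : ℕ} (X : Matrix (Fin n) (Fin n) ℝ) : EuclideanSpace ℝ (Fin n × Fin n) :=
  WithLp.toLp 2 fun p => X p.1 p.2

theorem norm_sq_toVec {n : ℕ} (X : Matrix (Fin n) (Fin n) ℝ) :
    ‖toVec X‖ ^ 2 = ∑ i, ∑ j, X i j ^ 2 := by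
  rw [EuclideanSpace.real_norm_sq_eq, Fintype.sum_prod_type]
  rfl

theorem norm_toVec {n : ℕ} (X : Matrix (Fin n) (Fin n) ℝ) : ‖toVec X‖ = ‖X‖ := by
  rw [← Real.sqrt_sq (norm_nonneg (toVec X)), norm_sq_toVec, Matrix.frobenius_norm_def,
    Real.sqrt_eq_rpow]
  simp

theorem toVec_sub {n : ℕ} (X Y : Matrix (Fin n) (Fin n) ℝ) :
    toVec (X - Y) = toVec X - toVec Y := rfl

theorem inner_toVec {n : ℕ} (A X : Matrix (Fin n) (Fin n) ℝ) :
    inner ℝ (toVec A) (toVec X) = (A.transpose * X).trace := by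
  rw [Matrix.trace, PiLp.inner_apply, Fintype.sum_prod_type, Finset.sum_comm]
  simp [toVec, Matrix.mul_apply, mul_comm]

theorem exists_linearIsometry_of_finrank_le {E : Type*} [NormedAddCommGroup E]
    [InnerProductSpace ℝ E] [FiniteDimensional ℝ E] {r : ℕ} (h : finrank ℝ E ≤ r) :
    Nonempty (E →ₗᵢ[ℝ] EuclideanSpace ℝ (Fin r)) := by
  let b := stdOrthonormalBasis ℝ E
  let e := EuclideanSpace.basisFun (Fin r) ℝ
  refine ⟨(b.toBasis.constr ℝ fun i => e (Fin.castLE h i)).isometryOfOrthonormal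
    (v := b.toBasis) (by simp) ?_⟩
  have : (b.toBasis.constr ℝ fun i => e (Fin.castLE h i)) ∘ b.toBasis =
      fun i => e (Fin.castLE h i) := by
    funext i; simp only [Function.comp_apply, Basis.constr_basis]
  rw [this]
  exact e.orthonormal.comp _ (Fin.castLE_injective h)

theorem sum_eq_sum_coe_of_support {n : ℕ} (S : Finset (Fin n)) (f : Fin n → ℝ)
    (hf : ∀ i, i ∉ S → f i = 0) : ∑ i, f i = ∑ i : S, f i := by
  rw [Finset.sum_coe_sort S f]
  exact (Finset.sum_subset (Finset.subset_univ S) fun i _ hi => hf i hi).symm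

/-- The matrix supported on `S × T` with rows `U (V i)`. -/
noncomputable def rowMatrix {n r : ℕ} (S T : Finset (Fin n))
    (U : EuclideanSpace ℝ (Fin r) →L[ℝ] EuclideanSpace ℝ T)
    (V : PiLp 2 fun _ : S => EuclideanSpace ℝ (Fin r)) : Matrix (Fin n) (Fin n) ℝ :=
  fun k l => if h : k ∈ S ∧ l ∈ T then U (V ⟨k, h.1⟩) ⟨l, h.2⟩ else 0

theorem norm_toVec_rowMatrix_le {n r : ℕ} (S T : Finset (Fin n))
    (U : EuclideanSpace ℝ (Fin r) →L[ℝ] EuclideanSpace ℝ T)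
    (V : PiLp 2 fun _ : S => EuclideanSpace ℝ (Fin r)) :
    ‖toVec (rowMatrix S T U V)‖ ≤ ‖U‖ * ‖V‖ := by
  refine le_of_sq_le_sq ?_ (by positivity)
  have h1 : ∑ k, ∑ l, rowMatrix S T U V k l ^ 2 = ∑ k : S, ‖U (V k)‖ ^ 2 := by
    rw [sum_eq_sum_coe_of_support S _ fun k hk => by simp [rowMatrix, hk]]
    refine Finset.sum_congr rfl fun k _ => ?_
    rw [sum_eq_sum_coe_of_support T _ fun l hl => by simp [rowMatrix, hl],
      EuclideanSpace.real_norm_sq_eq]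
    exact Finset.sum_congr rfl fun l _ => by simp [rowMatrix]
  rw [norm_sq_toVec, h1, mul_pow, PiLp.norm_sq_eq_of_L2, Finset.mul_sum]
  refine Finset.sum_le_sum fun k _ => ?_
  rw [← mul_pow]
  gcongr
  exact U.le_opNorm _

/-- `rowMatrix` as a continuous bilinear map. -/
noncomputable def rowMatrixCLM {n : ℕ} (r : ℕ) (S T : Finset (Fin n)) :
    (EuclideanSpace ℝ (Fin r) →L[ℝ] EuclideanSpace ℝ T) →L[ℝ]
      (PiLp 2 fun _ : S => EuclideanSpace ℝ (Fin r)) →L[ℝ] EuclideanSpace ℝ (Fin n × Fin n) :=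
  LinearMap.mkContinuous₂ (LinearMap.mk₂ ℝ (fun U V => toVec (rowMatrix S T U V))
    (fun U U' V => by ext p; by_cases h : p.1 ∈ S ∧ p.2 ∈ T <;> simp [toVec, rowMatrix, h])
    (fun c U V => by ext p; by_cases h : p.1 ∈ S ∧ p.2 ∈ T <;> simp [toVec, rowMatrix, h])
    (fun U V V' => by ext p; by_cases h : p.1 ∈ S ∧ p.2 ∈ T <;> simp [toVec, rowMatrix, h])
    (fun c U V => by ext p; by_cases h : p.1 ∈ S ∧ p.2 ∈ T <;> simp [toVec, rowMatrix, h]))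
    1 (fun U V => by rw [one_mul]; exact norm_toVec_rowMatrix_le S T U V)

theorem norm_rowMatrixCLM_le {n : ℕ} (r : ℕ) (S T : Finset (Fin n)) :
    ‖rowMatrixCLM r S T‖ ≤ 1 :=
  LinearMap.mkContinuous₂_norm_le _ zero_le_one _

/-- The row space `W` has dimension at most `r`, so it embeds isometrically by some `J` into `ℝ^r`.
Take for `V` the rows of `X` seen through `J`, and for `U` the adjoint of `J`. Since `J* J = 1`, the
rows are recovered; `J` preserves their norms, and `J*` is a contraction. -/
theorem exists_eq_rowMatrix {n r : ℕ} (S T : Finset (Fin n)) (X : Matrix (Fin n) (Fin n) ℝ)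
    (hr : X.rank ≤ r) (hS : ∀ i j, i ∉ S → X i j = 0) (hT : ∀ i j, j ∉ T → X i j = 0) :
    ∃ (U : EuclideanSpace ℝ (Fin r) →L[ℝ] EuclideanSpace ℝ T)
      (V : PiLp 2 fun _ : S => EuclideanSpace ℝ (Fin r)),
      ‖U‖ ≤ 1 ∧ ‖V‖ = ‖X‖ ∧ rowMatrix S T U V = X := by
  let P : (Fin n → ℝ) →ₗ[ℝ] EuclideanSpace ℝ T :=
    { toFun := fun x => WithLp.toLp 2 fun l => x l
      map_add' := fun x y => rfl
      map_smul' := fun c x => rfl }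
  let W : Submodule ℝ (EuclideanSpace ℝ T) := (Submodule.span ℝ (Set.range X.row)).map P
  have hW : finrank ℝ W ≤ r := by
    refine le_trans ?_ hr
    rw [Matrix.rank_eq_finrank_span_row]
    exact Submodule.finrank_map_le _ _
  have hmem : ∀ k, P (X k) ∈ W := fun k =>
    Submodule.mem_map_of_mem (Submodule.subset_span ⟨k, rfl⟩)
  obtain ⟨J⟩ := exists_linearIsometry_of_finrank_le hW
  have hJ : ∀ w, J.toContinuousLinearMap.adjoint (J w) = w := by
    intro w
    refine ext_inner_left ℝ fun w' => ?_
    rw [ContinuousLinearMap.adjoint_inner_right]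
    exact J.inner_map_map _ _
  refine ⟨W.subtypeL.comp J.toContinuousLinearMap.adjoint,
    WithLp.toLp 2 fun k => J ⟨P (X k), hmem k⟩, ?_, ?_, ?_⟩
  · refine (ContinuousLinearMap.opNorm_comp_le _ _).trans ?_
    rw [ContinuousLinearMap.adjoint.norm_map]
    calc _ ≤ (1 : ℝ) * 1 := by
          gcongr
          · exact W.norm_subtypeL_le
          · exact J.norm_toContinuousLinearMap_le
      _ = 1 := one_mul 1
  · rw [← norm_toVec]
    refine (sq_eq_sq₀ (norm_nonneg _) (norm_nonneg _)).1 ?_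
    rw [norm_sq_toVec, PiLp.norm_sq_eq_of_L2,
      sum_eq_sum_coe_of_support S _ fun k hk => by simp [hS k _ hk]]
    refine Finset.sum_congr rfl fun k _ => ?_
    rw [sum_eq_sum_coe_of_support T _ fun l hl => by simp [hT _ l hl]]
    simp only [J.norm_map, Submodule.coe_norm]
    rw [EuclideanSpace.real_norm_sq_eq]
    rfl
  · funext k l
    by_cases h : k ∈ S ∧ l ∈ T
    · simp only [rowMatrix, h, and_self, dite_true, ContinuousLinearMap.comp_apply, hJ]
      rfl
    · simp only [rowMatrix, h, dite_false]
      by_cases hk : k ∈ S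
      · exact (hT k l fun hl => h ⟨hk, hl⟩).symm
      · exact (hS k l hk).symm

/-- `N` is a `2 * ρ`-net of `K`, and linear maps which are bounded by `b` on `R` are bounded by
`4 * ρ * b` on the differences between the points of `K` and their approximations in `N`. -/
structure IsControlledNet {M : Type*} [NormedAddCommGroup M] [NormedSpace ℝ M] (K : Set M) (ρ : ℝ)
    (N R : Finset M) : Prop where
  subset : (N : Set M) ⊆ K
  norm_le : ∀ z ∈ R, ‖z‖ ≤ 1
  exists_approx : ∀ x ∈ K, ∃ p ∈ N, ‖x - p‖ ≤ 2 * ρ ∧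
    ∀ (m : ℕ) (L : M →L[ℝ] EuclideanSpace ℝ (Fin m)) (b : ℝ), (∀ z ∈ R, ‖L z‖ ≤ b) →
      ‖L (x - p)‖ ≤ 4 * ρ * b

theorem finrank_continuousLinearMap_euclideanSpace (r : ℕ) (ι : Type*) [Fintype ι] :
    finrank ℝ (EuclideanSpace ℝ (Fin r) →L[ℝ] EuclideanSpace ℝ ι) = r * Fintype.card ι := by
  rw [← (LinearMap.toContinuousLinearMap (𝕜 := ℝ) (E := EuclideanSpace ℝ (Fin r))
    (F' := EuclideanSpace ℝ ι)).finrank_eq, finrank_linearMap]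
  simp

theorem finrank_piLp_euclideanSpace (r : ℕ) (ι : Type*) [Fintype ι] :
    finrank ℝ (PiLp 2 fun _ : ι => EuclideanSpace ℝ (Fin r)) = r * Fintype.card ι := by
  rw [(WithLp.linearEquiv 2 ℝ (ι → EuclideanSpace ℝ (Fin r))).finrank_eq, finrank_pi_fintype]
  simp [mul_comm]

/-- Union over the pairs `(S, T)` of the nets for each bilinear parametrization. A point and its
approximation come from the same pair, hence their difference is handled by the test vectors of that
pair. -/
theorem exists_isControlledNet (n s r : ℕ) {ρ : ℝ} (hρ : 0 < ρ) :
    ∃ N R : Finset (EuclideanSpace ℝ (Fin n × Fin n)),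
      IsControlledNet (toVec '' unitBisparseLowRank n s r) ρ N R ∧
      (N.card : ℝ) ≤ (n.choose s : ℝ) ^ 2 * (1 + 2 / ρ) ^ (2 * (r * s)) ∧
      (R.card : ℝ) ≤ (n.choose s : ℝ) ^ 2 * 9 ^ (2 * (r * s)) := by
  classical
  let J := (Finset.univ : Finset (Fin n)).powersetCard s ×ˢ
    (Finset.univ : Finset (Fin n)).powersetCard s
  have hJ : (J.card : ℝ) = (n.choose s : ℝ) ^ 2 := by
    simp [J, Finset.card_product, sq]
  choose N R hNK hN hR hR1 happ using fun j : Finset (Fin n) × Finset (Fin n) =>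
    exists_net_of_bilinear (rowMatrixCLM r j.1 j.2) (norm_rowMatrixCLM_le r j.1 j.2)
      (toVec '' unitBisparseLowRank n s r) hρ
  have hdim : ∀ j ∈ J, finrank ℝ (EuclideanSpace ℝ (Fin r) →L[ℝ] EuclideanSpace ℝ j.2) +
      finrank ℝ (PiLp 2 fun _ : j.1 => EuclideanSpace ℝ (Fin r)) = 2 * (r * s) := by
    intro j hj
    simp only [J, Finset.mem_product, Finset.mem_powersetCard] at hj
    rw [finrank_continuousLinearMap_euclideanSpace, finrank_piLp_euclideanSpace,
      Fintype.card_coe, Fintype.card_coe, hj.1.2, hj.2.2, two_mul]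
  have hcard : ∀ (F : Finset (Fin n) × Finset (Fin n) →
      Finset (EuclideanSpace ℝ (Fin n × Fin n))) (b : ℝ), (∀ j ∈ J, ((F j).card : ℝ) ≤ b) →
      ((J.biUnion F).card : ℝ) ≤ (n.choose s : ℝ) ^ 2 * b := by
    intro F b hb
    rw [← hJ, ← nsmul_eq_mul]
    refine le_trans ?_ (Finset.sum_le_card_nsmul J (fun j => ((F j).card : ℝ)) b hb)
    exact_mod_cast Finset.card_biUnion_le
  refine ⟨J.biUnion N, J.biUnion R, ⟨?_, ?_, ?_⟩, hcard _ _ fun j hj => ?_,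
    hcard _ _ fun j hj => ?_⟩
  · intro p hp
    obtain ⟨j, -, hj⟩ := Finset.mem_biUnion.1 (Finset.mem_coe.1 hp)
    exact hNK j hj
  · intro z hz
    obtain ⟨j, -, hj⟩ := Finset.mem_biUnion.1 hz
    exact hR1 j z hj
  · rintro _ ⟨X, hX, rfl⟩
    have hX1 : ‖X‖ = 1 := hX.2
    obtain ⟨hr, S, T, hS, hT, hXS, hXT⟩ := hX.1
    have hmem : (S, T) ∈ J := by simp [J, hS, hT]
    obtain ⟨U, V, hU, hV, rfl⟩ := exists_eq_rowMatrix S T X hr hXS hXT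
    obtain ⟨p, hp, h⟩ := happ (S, T) U V hU (hV.trans hX1).le ⟨_, hX, rfl⟩
    exact ⟨p, Finset.mem_biUnion.2 ⟨_, hmem, hp⟩, h.1, fun m L b hb =>
      h.2 m L b fun z hz => hb z (Finset.mem_biUnion.2 ⟨_, hmem, hz⟩)⟩
  · rw [← hdim j hj]; exact hN j
  · rw [← hdim j hj]; exact hR j

/-! ### Tail bounds for products and Gaussian estimates -/

open ProbabilityTheory Real

section ProductMeasure

variable {X : Type*} [MeasurableSpace X] (ν : Measure X) [IsProbabilityMeasure ν] (m : ℕ)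

/-- Markov's inequality for a product of independent copies. -/
theorem measureReal_pi_le_prod_le {f : X → ℝ} (hf : 0 ≤ f) (hfi : Integrable f ν) {b t : ℝ}
    (hb : ∫ x, f x ∂ν ≤ b) (ht : 0 < t) :
    (Measure.pi fun _ : Fin m => ν).real {x | t ≤ ∏ i, f (x i)} ≤ b ^ m / t := by
  have hint : Integrable (fun x : Fin m → X => ∏ i, f (x i)) (Measure.pi fun _ : Fin m => ν) :=
    Integrable.fintype_prod fun _ => hfi
  have h := mul_meas_ge_le_integral_of_nonneg
    (ae_of_all _ fun x : Fin m → X => Finset.prod_nonneg fun i _ => hf (x i)) hint t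
  rw [integral_fintype_prod_eq_pow f, Fintype.card_fin] at h
  rw [le_div_iff₀ ht, mul_comm]
  exact h.trans (pow_le_pow_left₀ (integral_nonneg hf) hb m)

/-- Lower tail bound for the number of samples in a given set. -/
theorem measureReal_pi_sum_indicator_le {B : Set X} (hB : MeasurableSet B) {p : ℝ}
    (hp : p ≤ ν.real B) :
    (Measure.pi fun _ : Fin m => ν).real {x | ∑ i, B.indicator 1 (x i) ≤ p * m / 2} ≤
      exp (-(p * m / 10)) := by
  -- This gives `E exp(-1_B) ≤ 1 - 0.6 p ≤ exp(-0.6 p)`. Against the threshold `p m / 2` an exponent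
  -- of `0.1 p m` is left.
  have he : exp (-1) ≤ 0.4 := by
    rw [exp_neg, inv_le_comm₀ (exp_pos _) (by norm_num)]
    linarith [exp_one_gt_d9]
  by_cases hp0 : p < 0
  · refine measureReal_le_one.trans (one_le_exp ?_)
    have : p * m ≤ 0 := mul_nonpos_of_nonpos_of_nonneg hp0.le (by positivity)
    linarith
  push Not at hp0
  have hfe : (fun x => exp (-(B.indicator 1 x : ℝ))) =
      fun x => 1 - B.indicator (fun _ => 1 - exp (-1)) x := by
    funext x
    by_cases hx : x ∈ B <;> simp [hx]
  have hind : Integrable (B.indicator fun _ => 1 - exp (-1)) ν :=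
    (integrable_const _).indicator hB
  have hint : ∫ x, exp (-(B.indicator 1 x : ℝ)) ∂ν ≤ exp (-(0.6 * p)) := by
    rw [hfe, integral_sub (integrable_const _) hind, integral_indicator hB]
    simp only [integral_const, probReal_univ, smul_eq_mul, measureReal_restrict_apply_univ]
    have := add_one_le_exp (-(0.6 * p))
    nlinarith
  have hfi : Integrable (fun x => exp (-(B.indicator 1 x : ℝ))) ν := by
    rw [hfe]; exact (integrable_const _).sub hind
  have key := measureReal_pi_le_prod_le ν m (fun x => (exp_pos _).le) hfi hint
    (exp_pos (-(p * m / 2)))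
  refine le_trans (le_of_eq ?_) (key.trans (le_of_eq ?_))
  · congr 1
    ext x
    simp only [Set.mem_ofPred_eq]
    rw [← exp_sum, exp_le_exp, Finset.sum_neg_distrib, neg_le_neg_iff]
  · rw [← exp_nat_mul, ← exp_sub]
    congr 1
    ring

end ProductMeasure

section RealGaussian

theorem measure_gaussianReal_Ici_pos : 0 < (gaussianReal 0 1).real (Set.Ici 1) := by
  refine ENNReal.toReal_pos (fun h => ?_) (measure_ne_top _ _)
  have := gaussianReal_absolutelyContinuous' 0 one_ne_zero h
  simp at this

theorem le_measure_gaussianReal_Icc {δ : ℝ} (h0 : 0 ≤ δ) (h1 : δ ≤ 1) :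
    2 * δ * gaussianPDFReal 0 1 1 ≤ (gaussianReal 0 1).real (Set.Icc (-δ) δ) := by
  rw [Measure.real, gaussianReal_apply_eq_integral _ one_ne_zero, ENNReal.toReal_ofReal
    (integral_nonneg fun x => gaussianPDFReal_nonneg _ _ _)]
  have hc : ∫ _ in Set.Icc (-δ) δ, gaussianPDFReal 0 1 1 = 2 * δ * gaussianPDFReal 0 1 1 := by
    rw [setIntegral_const, Measure.real, Real.volume_Icc, ENNReal.toReal_ofReal (by linarith),
      smul_eq_mul]
    ring
  rw [← hc]
  refine setIntegral_mono_on (integrableOn_const (by simp))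
    (integrable_gaussianPDFReal _ _).integrableOn measurableSet_Icc fun x hx => ?_
  simp only [gaussianPDFReal_def]
  have : x ^ 2 ≤ 1 := by nlinarith [hx.1, hx.2]
  refine mul_le_mul_of_nonneg_left (exp_le_exp.2 ?_) (by positivity)
  simp only [sub_zero, NNReal.coe_one]
  linarith

theorem gaussianPDFReal_mul_exp_sq (x : ℝ) :
    gaussianPDFReal 0 1 x • exp (x ^ 2 / 4) = (√(2 * π))⁻¹ * exp (-(1 / 4) * x ^ 2) := by
  rw [gaussianPDFReal_def, smul_eq_mul, mul_assoc, ← exp_add]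
  congr 2
  · simp
  · simp; ring

theorem integrable_exp_sq_gaussianReal :
    Integrable (fun x => exp (x ^ 2 / 4)) (gaussianReal 0 1) := by
  rw [gaussianReal_of_var_ne_zero _ one_ne_zero, integrable_withDensity_iff_integrable_smul'
    (measurable_gaussianPDF _ _) (ae_of_all _ fun _ => gaussianPDF_lt_top)]
  simp only [toReal_gaussianPDF, gaussianPDFReal_mul_exp_sq]
  exact (integrable_exp_neg_mul_sq (by norm_num)).const_mul _

theorem integral_exp_sq_gaussianReal_le : ∫ x, exp (x ^ 2 / 4) ∂(gaussianReal 0 1) ≤ exp 1 := by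
  rw [integral_gaussianReal_eq_integral_smul one_ne_zero]
  simp only [gaussianPDFReal_mul_exp_sq]
  rw [integral_const_mul, integral_gaussian, inv_mul_eq_div, ← sqrt_div (by positivity)]
  have : π / (1 / 4) / (2 * π) = 2 := by field_simp; norm_num
  rw [this]
  have h2 : √2 ≤ 2 := by rw [sqrt_le_left (by norm_num)]; norm_num
  linarith [exp_one_gt_d9]

end RealGaussian

section StdGaussian

variable {M : Type*} [NormedAddCommGroup M] [InnerProductSpace ℝ M] [FiniteDimensional ℝ M]
  [MeasurableSpace M] [BorelSpace M]

/-- Stating the law as a dilation of the standard Gaussian covers `z = 0` and makes the dependence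
on `‖z‖` explicit. -/
theorem map_inner_stdGaussian (z : M) :
    (stdGaussian M).map (fun x => inner ℝ z x) = (gaussianReal 0 1).map (‖z‖ * ·) := by
  have h := IsGaussian.map_eq_gaussianReal (μ := stdGaussian M) (innerSL ℝ z)
  rw [integral_strongDual_stdGaussian, variance_dual_stdGaussian, innerSL_apply_norm] at h
  rw [gaussianReal_map_const_mul]
  convert h using 2
  · rfl
  · rw [mul_zero]
  · rw [mul_one]
    exact NNReal.eq (Real.coe_toNNReal _ (sq_nonneg _)).symm

theorem measureReal_inner_stdGaussian (z : M) {B : Set ℝ} (hB : MeasurableSet B) :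
    (stdGaussian M).real {x | inner ℝ z x ∈ B} = (gaussianReal 0 1).real {t | ‖z‖ * t ∈ B} := by
  have h := congrArg (fun μ => μ.real B) (map_inner_stdGaussian z)
  simp only [Measure.real] at h
  rwa [Measure.map_apply (by fun_prop) hB, Measure.map_apply (by fun_prop) hB] at h

theorem indepFun_inner_stdGaussian {y z : M} (h : inner ℝ y z = 0) :
    IndepFun (fun x => inner ℝ y x) (fun x => inner ℝ z x) (stdGaussian M) := by
  refine HasGaussianLaw.indepFun_of_covariance_eq_zero ?_ ?_
  · exact IsGaussian.hasGaussianLaw_id.map_fun ((innerSL ℝ y).prod (innerSL ℝ z))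
  · rw [← covarianceBilin_apply_eq_cov IsGaussian.memLp_two_id, covarianceBilin_stdGaussian]
    exact h

/-- `sepConst * ε` bounds below the probability that a random hyperplane strongly separates two
unit vectors at distance at least `ε / 2`. -/
noncomputable def sepConst : ℝ :=
  (gaussianReal 0 1).real (Set.Ici 1) * gaussianPDFReal 0 1 1 / 4

theorem sepConst_pos : 0 < sepConst := by
  have := measure_gaussianReal_Ici_pos
  have := gaussianPDFReal_pos 0 1 1 one_ne_zero
  unfold sepConst
  positivity

theorem sepConst_le_one : sepConst ≤ 1 := by
  have h1 : (gaussianReal 0 1).real (Set.Ici 1) ≤ 1 := measureReal_le_one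
  have h2 := (le_measure_gaussianReal_Icc zero_le_one le_rfl).trans measureReal_le_one
  have h3 := gaussianPDFReal_pos 0 1 1 one_ne_zero
  have h4 := measure_gaussianReal_Ici_pos
  unfold sepConst
  nlinarith

/-- For unit vectors, `p + q` and `p - q` are orthogonal, so their products with a Gaussian vector
are independent. The event that the first is at most `‖p - q‖ / 2` in absolute value, of probability
at least of order `ε`, and the second at least `‖p - q‖`, of probability bounded below, forces a
margin of `‖p - q‖ / 4 ≥ ε / 8`. -/
theorem le_measure_separating {ε : ℝ} (h0 : 0 < ε) (h2 : ε ≤ 2) {p q : M} (hp : ‖p‖ = 1)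
    (hq : ‖q‖ = 1) (hpq : ε / 2 ≤ ‖p - q‖) :
    sepConst * ε ≤
      (stdGaussian M).real {x | ε / 16 < inner ℝ p x ∧ inner ℝ q x < -(ε / 16)} := by
  have hD : 0 < ‖p - q‖ := by linarith
  have hsum : ‖p + q‖ ≤ 2 := (norm_add_le p q).trans (by rw [hp, hq]; norm_num)
  have horth : inner ℝ (p + q) (p - q) = 0 := by
    rw [inner_add_left, inner_sub_right, inner_sub_right, real_inner_self_eq_norm_sq,
      real_inner_self_eq_norm_sq, hp, hq, real_inner_comm]
    ring
  have hind := indepFun_inner_stdGaussian horth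
  have hmeas := hind.measure_inter_preimage_eq_mul
    (Set.Icc (-(‖p - q‖ / 2)) (‖p - q‖ / 2)) (Set.Ici ‖p - q‖) measurableSet_Icc measurableSet_Ici
  have hmul := congrArg ENNReal.toReal hmeas
  rw [ENNReal.toReal_mul] at hmul
  have e1 := measureReal_inner_stdGaussian (p + q)
    (measurableSet_Icc (a := -(‖p - q‖ / 2)) (b := ‖p - q‖ / 2))
  have e2 := measureReal_inner_stdGaussian (p - q) (measurableSet_Ici (a := ‖p - q‖))
  have l1 : 2 * (ε / 8) * gaussianPDFReal 0 1 1 ≤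
      (gaussianReal 0 1).real {t | ‖p + q‖ * t ∈ Set.Icc (-(‖p - q‖ / 2)) (‖p - q‖ / 2)} := by
    refine (le_measure_gaussianReal_Icc (by linarith) (by linarith)).trans ?_
    refine measureReal_mono fun t ht => ?_
    have ht' : |t| ≤ ε / 8 := abs_le.2 ht
    refine abs_le.1 ?_
    rw [abs_mul, abs_norm]
    calc ‖p + q‖ * |t| ≤ 2 * (ε / 8) := by gcongr
      _ ≤ ‖p - q‖ / 2 := by linarith
  have l2 : (gaussianReal 0 1).real (Set.Ici 1) ≤
      (gaussianReal 0 1).real {t | ‖p - q‖ * t ∈ Set.Ici ‖p - q‖} := by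
    refine measureReal_mono fun t ht => ?_
    exact le_mul_of_one_le_right hD.le ht
  have hsub : (stdGaussian M).real
      ((fun x => inner ℝ (p + q) x) ⁻¹' Set.Icc (-(‖p - q‖ / 2)) (‖p - q‖ / 2) ∩
        (fun x => inner ℝ (p - q) x) ⁻¹' Set.Ici ‖p - q‖) ≤
      (stdGaussian M).real {x | ε / 16 < inner ℝ p x ∧ inner ℝ q x < -(ε / 16)} := by
    refine measureReal_mono fun x hx => ?_
    obtain ⟨⟨h3, h4⟩, h5⟩ := hx
    simp only [inner_add_left, inner_sub_left, Set.mem_preimage, Set.mem_Ici] at h3 h4 h5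
    constructor <;> linarith
  refine le_trans ?_ hsub
  have hgoal : sepConst * ε = 2 * (ε / 8) * gaussianPDFReal 0 1 1 *
      (gaussianReal 0 1).real (Set.Ici 1) := by
    unfold sepConst; ring
  rw [hgoal]
  refine le_trans (mul_le_mul l1 l2 measureReal_nonneg measureReal_nonneg) (le_of_eq ?_)
  rw [← e1, ← e2]
  exact hmul.symm

theorem integrable_exp_inner_sq {z : M} (hz : ‖z‖ ≤ 1) :
    Integrable (fun x => exp (inner ℝ z x ^ 2 / 4)) (stdGaussian M) ∧
      ∫ x, exp (inner ℝ z x ^ 2 / 4) ∂(stdGaussian M) ≤ exp 1 := by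
  have hle : ∀ t : ℝ, exp ((‖z‖ * t) ^ 2 / 4) ≤ exp (t ^ 2 / 4) := fun t => by
    have : ‖z‖ ^ 2 ≤ 1 := pow_le_one₀ (norm_nonneg z) hz
    rw [mul_pow]
    gcongr
    exact mul_le_of_le_one_left (sq_nonneg t) this
  have hi : Integrable (fun t : ℝ => exp ((‖z‖ * t) ^ 2 / 4)) (gaussianReal 0 1) := by
    refine integrable_exp_sq_gaussianReal.mono' (by fun_prop) (ae_of_all _ fun t => ?_)
    rw [norm_of_nonneg (exp_pos _).le]
    exact hle t
  have hsm : ∀ μ : Measure ℝ, AEStronglyMeasurable (fun t : ℝ => exp (t ^ 2 / 4)) μ := fun μ =>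
    by fun_prop
  have hmap := map_inner_stdGaussian z
  constructor
  · have := (integrable_map_measure (hsm _) (f := fun x : M => inner ℝ z x)
      (μ := stdGaussian M) (by fun_prop)).1 ?_
    · exact this
    · rw [hmap]
      exact (integrable_map_measure (hsm _) (by fun_prop)).2 hi
  · have h1 := integral_map (μ := stdGaussian M) (φ := fun x : M => inner ℝ z x)
      (by fun_prop) (hsm _)
    have h2 := integral_map (μ := gaussianReal 0 1) (φ := fun t => ‖z‖ * t) (by fun_prop) (hsm _)
    rw [← h1, hmap, h2]
    exact (integral_mono hi integrable_exp_sq_gaussianReal hle).trans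
      integral_exp_sq_gaussianReal_le

/-- Upper tail bound for a sum of squares of Gaussian variables. -/
theorem measureReal_pi_le_sum_inner_sq (m : ℕ) {z : M} (hz : ‖z‖ ≤ 1) :
    (Measure.pi fun _ : Fin m => stdGaussian M).real {x | 8 * (m : ℝ) ≤ ∑ i, inner ℝ z (x i) ^ 2} ≤
      exp (-m) := by
  obtain ⟨hi, hb⟩ := integrable_exp_inner_sq hz
  have key := measureReal_pi_le_prod_le (stdGaussian M) m (fun x => (exp_pos _).le) hi hb
    (exp_pos (2 * m))
  refine le_trans (le_of_eq ?_) (key.trans (le_of_eq ?_))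
  · congr 1
    ext x
    simp only [Set.mem_ofPred_eq]
    rw [← exp_sum, exp_le_exp, ← Finset.sum_div]
    constructor <;> intro h <;> linarith
  · rw [← exp_nat_mul, ← exp_sub]
    congr 1
    ring

end StdGaussian

/-! ### Hyperplane tessellations of a set with a controlled net -/

section Tessellation

variable {M : Type*} [NormedAddCommGroup M] [InnerProductSpace ℝ M]

/-- The vectors whose hyperplane separates `p` from `q` with margin `ε / 16`. -/
def separating (ε : ℝ) (p q : M) : Set M :=
  {x | ε / 16 < inner ℝ p x ∧ inner ℝ q x < -(ε / 16)}

/-- The linear map with coordinates `v ↦ ⟨v, x i⟩`. -/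
noncomputable def innerMap {m : ℕ} (x : Fin m → M) : M →L[ℝ] EuclideanSpace ℝ (Fin m) :=
  (PiLp.continuousLinearEquiv 2 ℝ fun _ : Fin m => ℝ).symm.toContinuousLinearMap.comp
    (ContinuousLinearMap.pi fun i => innerSL ℝ (x i))

theorem norm_sq_innerMap {m : ℕ} (x : Fin m → M) (v : M) :
    ‖innerMap x v‖ ^ 2 = ∑ i, inner ℝ v (x i) ^ 2 := by
  rw [EuclideanSpace.real_norm_sq_eq]
  refine Finset.sum_congr rfl fun i _ => ?_
  rw [real_inner_comm]
  rfl

/-- A pair of points which is strongly separated by `x` can only be approximated by a pair of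
points on the same side at the expense of a large deviation. -/
theorem indicator_separating_le {ε : ℝ} (hε : 0 < ε) {p q X X' x : M}
    (h : 0 ≤ inner ℝ X x ↔ 0 ≤ inner ℝ X' x) :
    (separating ε p q).indicator 1 x ≤
      (inner ℝ (X - p) x ^ 2 + inner ℝ (X' - q) x ^ 2) / (ε / 16) ^ 2 := by
  by_cases hx : x ∈ separating ε p q
  · rw [Set.indicator_of_mem hx, Pi.one_apply, le_div_iff₀ (by positivity), one_mul]
    obtain ⟨h1, h2⟩ := hx
    rw [inner_sub_left, inner_sub_left]
    by_cases h0 : 0 ≤ inner ℝ X x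
    · have := h.1 h0
      nlinarith [sq_nonneg (inner ℝ X x - inner ℝ p x)]
    · push Not at h0
      nlinarith [sq_nonneg (inner ℝ X' x - inner ℝ q x)]
  · rw [Set.indicator_of_notMem hx]
    positivity

theorem norm_sub_le_of_separating {ε : ℝ} (h0 : 0 < ε) (h2 : ε ≤ 2) {m : ℕ} (hm : 0 < m)
    {K : Set M} {N R : Finset M} (hnet : IsControlledNet K (sepConst * ε ^ 2 / 1024) N R)
    (x : Fin m → M)
    (hN : ∀ p ∈ N, ∀ q ∈ N, ε / 2 ≤ ‖p - q‖ →
      sepConst * ε * m / 2 < ∑ i, (separating ε p q).indicator 1 (x i))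
    (hR : ∀ z ∈ R, ∑ i, inner ℝ z (x i) ^ 2 ≤ 8 * m) {X X' : M} (hX : X ∈ K) (hX' : X' ∈ K)
    (hsgn : ∀ i, 0 ≤ inner ℝ X (x i) ↔ 0 ≤ inner ℝ X' (x i)) : ‖X - X'‖ ≤ ε := by
  by_contra! hcon
  have hκ := sepConst_pos
  have hκ1 := sepConst_le_one
  have hm' : (0 : ℝ) < m := by exact_mod_cast hm
  obtain ⟨p, hp, hXp, hLp⟩ := hnet.exists_approx X hX
  obtain ⟨q, hq, hXq, hLq⟩ := hnet.exists_approx X' hX'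
  set ρ := sepConst * ε ^ 2 / 1024 with hρ
  have hρε : 2 * ρ ≤ ε / 4 := by nlinarith [mul_pos hκ h0]
  have hpq : ε / 2 ≤ ‖p - q‖ := by
    have e : X - X' = (X - p) + (p - q) - (X' - q) := by abel
    have t1 := norm_sub_le ((X - p) + (p - q)) (X' - q)
    have t2 := norm_add_le (X - p) (p - q)
    rw [← e] at t1
    linarith
  have hb : ∀ z ∈ R, ‖innerMap x z‖ ≤ √(8 * m) := fun z hz => by
    refine le_sqrt_of_sq_le ?_
    rw [norm_sq_innerMap]
    exact hR z hz
  have hsq : ∀ v, ‖innerMap x v‖ ≤ 4 * ρ * √(8 * m) →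
      ∑ i, inner ℝ v (x i) ^ 2 ≤ 128 * ρ ^ 2 * m := fun v hv => by
    rw [← norm_sq_innerMap]
    refine (pow_le_pow_left₀ (norm_nonneg _) hv 2).trans (le_of_eq ?_)
    rw [mul_pow, sq_sqrt (by positivity)]
    ring
  have h3 := hsq _ (hLp m (innerMap x) _ hb)
  have h4 := hsq _ (hLq m (innerMap x) _ hb)
  have h5 : ∑ i, (separating ε p q).indicator 1 (x i) ≤
      (∑ i, inner ℝ (X - p) (x i) ^ 2 + ∑ i, inner ℝ (X' - q) (x i) ^ 2) / (ε / 16) ^ 2 := by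
    rw [← Finset.sum_add_distrib, Finset.sum_div]
    exact Finset.sum_le_sum fun i _ => indicator_separating_le h0 (hsgn i)
  have h6 : (∑ i, inner ℝ (X - p) (x i) ^ 2 + ∑ i, inner ℝ (X' - q) (x i) ^ 2) / (ε / 16) ^ 2 ≤
      sepConst * ε * m / 2 := by
    rw [div_le_iff₀ (by positivity)]
    refine (add_le_add h3 h4).trans ?_
    -- The power `ε²` in `ρ` leaves the spare factor `sepConst * ε / 8 ≤ 1`.
    have e : 128 * ρ ^ 2 * m + 128 * ρ ^ 2 * m =
        sepConst * ε * m / 2 * (ε / 16) ^ 2 * (sepConst * ε / 8) := by rw [hρ]; ring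
    rw [e]
    refine mul_le_of_le_one_right (by positivity) ?_
    nlinarith
  exact absurd (h5.trans h6) (hN p hp q hq hpq).not_ge

variable [FiniteDimensional ℝ M] [MeasurableSpace M] [BorelSpace M]

theorem measurableSet_separating (ε : ℝ) (p q : M) : MeasurableSet (separating ε p q) := by
  have h : ∀ z : M, Measurable fun x : M => inner ℝ z x := fun z => by fun_prop
  exact (measurableSet_lt measurable_const (h p)).inter (measurableSet_lt (h q) measurable_const)

/-- The hyperplanes orthogonal to `m` Gaussian vectors induce a tessellation of `K` into cells of
diameter at most `ε`, up to an exceptional set controlled by the size of a net of `K`. -/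
theorem exists_measurableSet_tessellation {ε : ℝ} (h0 : 0 < ε) (h2 : ε ≤ 2) {m : ℕ} (hm : 0 < m)
    {K : Set M} (hK : ∀ X ∈ K, ‖X‖ = 1) {N R : Finset M}
    (hnet : IsControlledNet K (sepConst * ε ^ 2 / 1024) N R) :
    ∃ G : Set (Fin m → M), MeasurableSet G ∧
      (Measure.pi fun _ : Fin m => stdGaussian M).real Gᶜ ≤
        (N.card : ℝ) ^ 2 * exp (-(sepConst * ε * m / 10)) + R.card * exp (-m) ∧
      ∀ x ∈ G, ∀ X ∈ K, ∀ X' ∈ K,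
        (∀ i, 0 ≤ inner ℝ X (x i) ↔ 0 ≤ inner ℝ X' (x i)) → ‖X - X'‖ ≤ ε := by
  classical
  let B₁ : M × M → Set (Fin m → M) := fun w =>
    {x | ∑ i, (separating ε w.1 w.2).indicator 1 (x i) ≤ sepConst * ε * m / 2}
  let B₂ : M → Set (Fin m → M) := fun z => {x | 8 * (m : ℝ) ≤ ∑ i, inner ℝ z (x i) ^ 2}
  let I := (N ×ˢ N).filter fun w => ε / 2 ≤ ‖w.1 - w.2‖
  have hI : (I.card : ℝ) ≤ (N.card : ℝ) ^ 2 := by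
    rw [sq, ← Nat.cast_mul, ← Finset.card_product]
    exact_mod_cast Finset.card_filter_le _ _
  have hB₁ : ∀ w, MeasurableSet (B₁ w) := fun w => by
    refine measurableSet_le (Finset.measurable_sum _ fun i _ => ?_) measurable_const
    exact (measurable_one.indicator (measurableSet_separating ε w.1 w.2)).comp
      (measurable_pi_apply i)
  have hB₂ : ∀ z, MeasurableSet (B₂ z) := fun z =>
    measurableSet_le measurable_const (by fun_prop)
  refine ⟨((⋃ w ∈ I, B₁ w) ∪ ⋃ z ∈ R, B₂ z)ᶜ,
    ((I.measurableSet_biUnion fun w _ => hB₁ w).union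
      (R.measurableSet_biUnion fun z _ => hB₂ z)).compl, ?_, ?_⟩
  · rw [compl_compl]
    refine (measureReal_union_le _ _).trans (add_le_add ?_ ?_)
    · refine (measureReal_biUnion_finset_le _ _).trans ?_
      refine (Finset.sum_le_card_nsmul _ _ (exp (-(sepConst * ε * m / 10))) fun w hw => ?_).trans ?_
      · simp only [I, Finset.mem_filter, Finset.mem_product] at hw
        exact measureReal_pi_sum_indicator_le _ m (measurableSet_separating ε w.1 w.2)
          (le_measure_separating h0 h2 (hK _ (hnet.subset hw.1.1)) (hK _ (hnet.subset hw.1.2)) hw.2)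
      · rw [nsmul_eq_mul]
        gcongr
    · refine (measureReal_biUnion_finset_le _ _).trans ?_
      refine (Finset.sum_le_card_nsmul _ _ (exp (-m)) fun z hz => ?_).trans
        (nsmul_eq_mul _ _).le
      exact measureReal_pi_le_sum_inner_sq m (hnet.norm_le z hz)
  · intro x hx X hX X' hX' hsgn
    simp only [Set.mem_compl_iff, Set.mem_union, Set.mem_iUnion, not_or, not_exists] at hx
    refine norm_sub_le_of_separating h0 h2 hm hnet x (fun p hp q hq hpq => ?_) (fun z hz => ?_)
      hX hX' hsgn
    · exact not_le.1 (hx.1 (p, q) (Finset.mem_filter.2 ⟨Finset.mk_mem_product hp hq, hpq⟩))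
    · exact (not_le.1 (hx.2 z hz)).le

end Tessellation

/-! ### Transfer to Gaussian random maps -/

theorem map_pi_gaussianReal_curry (n m : ℕ) :
    (Measure.pi fun _ : Fin m × Fin n × Fin n => gaussianReal 0 1).map
        (fun y i => (WithLp.toLp 2 fun p => y (i, p) : EuclideanSpace ℝ (Fin n × Fin n))) =
      Measure.pi fun _ : Fin m => stdGaussian (EuclideanSpace ℝ (Fin n × Fin n)) := by
  have h := Measure.infinitePi_map_curry (ι := Fin m) (κ := Fin n × Fin n) (X := ℝ)
    fun _ _ => gaussianReal 0 1
  simp only [Measure.infinitePi_eq_pi] at h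
  have h2 := Measure.pi_map_pi (μ := fun _ : Fin m => Measure.pi fun _ : Fin n × Fin n =>
    gaussianReal 0 1) (f := fun _ => WithLp.toLp 2) (fun _ => by fun_prop)
  simp only [map_pi_eq_stdGaussian] at h2
  rw [← h2, ← h, Measure.map_map (by fun_prop) (by fun_prop)]
  rfl

theorem IsGaussianFamily.hasLaw_toVec {Ω : Type*} [MeasurableSpace Ω] {P : Measure Ω}
    [IsProbabilityMeasure P] {n m : ℕ} {A : Fin m → Ω → Matrix (Fin n) (Fin n) ℝ}
    (hA : IsGaussianFamily P A) :
    HasLaw (fun ω i => toVec (A i ω))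
      (Measure.pi fun _ : Fin m => stdGaussian (EuclideanSpace ℝ (Fin n × Fin n))) P := by
  have hae : ∀ p : Fin m × Fin n × Fin n, AEMeasurable (fun ω => A p.1 ω p.2.1 p.2.2) P :=
    fun p => (hA.2 p.1 p.2.1 p.2.2).aemeasurable
  have hmap := (iIndepFun_iff_map_fun_eq_pi_map hae).1 hA.1
  simp only [(hA.2 _ _ _).map_eq] at hmap
  have hF : Measurable fun (y : Fin m × Fin n × Fin n → ℝ) (i : Fin m) =>
      (WithLp.toLp 2 fun p => y (i, p) : EuclideanSpace ℝ (Fin n × Fin n)) := by fun_prop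
  refine ⟨hF.comp_aemeasurable (aemeasurable_pi_lambda _ hae), ?_⟩
  rw [← map_pi_gaussianReal_curry, ← hmap,
    AEMeasurable.map_map_of_aemeasurable hF.aemeasurable (aemeasurable_pi_lambda _ hae)]
  rfl

theorem exists_isGaussianFamily (n m : ℕ) :
    IsGaussianFamily (Measure.pi fun _ : Fin m × Fin n × Fin n => gaussianReal 0 1)
      fun i ω k l => ω (i, k, l) := by
  refine ⟨iIndepFun_pi (X := fun _ => id) fun _ => aemeasurable_id, fun i k l => ?_⟩
  exact ⟨(measurable_pi_apply _).aemeasurable,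
    (measurePreserving_eval (fun _ : Fin m × Fin n × Fin n => gaussianReal 0 1) (i, k, l)).map_eq⟩

theorem nonneg_iff_of_oneBit_eq {n m : ℕ} {A : Fin m → Matrix (Fin n) (Fin n) ℝ}
    {X X' : Matrix (Fin n) (Fin n) ℝ}
    (h : oneBit (measurementMap A) X = oneBit (measurementMap A) X') (i : Fin m) :
    0 ≤ inner ℝ (toVec X) (toVec (A i)) ↔ 0 ≤ inner ℝ (toVec X') (toVec (A i)) := by
  have hi := congrFun h i
  change sgn ((A i).transpose * X).trace = sgn ((A i).transpose * X').trace at hi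
  rw [← inner_toVec, ← inner_toVec, real_inner_comm, real_inner_comm (toVec X')] at hi
  unfold sgn at hi
  split_ifs at hi with h1 h2 h2
  · exact iff_of_true h1 h2
  · norm_num at hi
  · norm_num at hi
  · exact iff_of_false h1 h2

theorem exists_event_of_isControlledNet {n s r m : ℕ} (hm : 0 < m) {ε : ℝ} (h0 : 0 < ε)
    (h2 : ε ≤ 2) {N R : Finset (EuclideanSpace ℝ (Fin n × Fin n))}
    (hnet : IsControlledNet (toVec '' unitBisparseLowRank n s r) (sepConst * ε ^ 2 / 1024) N R)
    {Ω : Type*} [MeasurableSpace Ω] {P : Measure Ω} [IsProbabilityMeasure P]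
    {A : Fin m → Ω → Matrix (Fin n) (Fin n) ℝ} (hA : IsGaussianFamily P A) :
    ∃ E : Set Ω, MeasurableSet E ∧
      1 - ((N.card : ℝ) ^ 2 * exp (-(sepConst * ε * m / 10)) + R.card * exp (-m)) ≤ P.real E ∧
      ∀ ω ∈ E, ∀ X ∈ unitBisparseLowRank n s r, ∀ X' ∈ unitBisparseLowRank n s r,
        oneBit (measurementMap fun i => A i ω) X = oneBit (measurementMap fun i => A i ω) X' →
          ‖X - X'‖ ≤ ε := by
  obtain ⟨G, hG, hGc, hsep⟩ := exists_measurableSet_tessellation h0 h2 hm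
    (by rintro _ ⟨X, hX, rfl⟩; rw [norm_toVec]; exact hX.2) hnet
  have hlaw := hA.hasLaw_toVec
  -- The entries are only almost everywhere measurable, so the preimage of `G` is replaced by a
  -- measurable subset of equal probability.
  obtain ⟨E, hEG, hE, hEae⟩ :=
    (hlaw.aemeasurable.nullMeasurable hG).exists_measurable_subset_ae_eq
  refine ⟨E, hE, ?_, fun ω hω X hX X' hX' h => ?_⟩
  · rw [measureReal_congr hEae, ← map_measureReal_apply_of_aemeasurable hlaw.aemeasurable hG,
      hlaw.map_eq]
    rw [probReal_compl_eq_one_sub hG] at hGc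
    linarith
  · rw [← norm_toVec, toVec_sub]
    exact hsep _ (hEG hω) _ ⟨X, hX, rfl⟩ _ ⟨X', hX', rfl⟩ (nonneg_iff_of_oneBit_eq h)

/-! ### Counting and choice of constants -/

theorem choose_le_exp_mul_div_pow {n s : ℕ} (hs : 0 < s) :
    (n.choose s : ℝ) ≤ (exp 1 * (n / s)) ^ s := by
  have hs' : (0 : ℝ) < s := by exact_mod_cast hs
  have h1 : (n.choose s : ℝ) ≤ (n : ℝ) ^ s / s.factorial := Nat.choose_le_pow_div s n
  have h2 := pow_div_factorial_le_exp (s : ℝ) hs'.le s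
  have e : (n : ℝ) ^ s / s.factorial = (n / s : ℝ) ^ s * ((s : ℝ) ^ s / s.factorial) := by
    rw [div_pow]; field_simp
  rw [mul_pow, ← exp_nat_mul, mul_one, mul_comm]
  refine h1.trans (e.trans_le ?_)
  gcongr

theorem half_le_log {x : ℝ} (hx : 2 ≤ x) : 1 / 2 ≤ log x := by
  have := log_le_log two_pos hx
  linarith [log_two_gt_d9]

theorem choose_le_exp_log {n s : ℕ} (hs : 0 < s) {ε : ℝ} (h0 : 0 < ε) (h2 : ε ≤ 2)
    (hx : 2 ≤ n / (ε * s)) : (n.choose s : ℝ) ≤ exp (4 * s * log (n / (ε * s))) := by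
  set x := n / (ε * s) with hxdef
  have hs' : (0 : ℝ) < s := by exact_mod_cast hs
  have hx0 : 0 < x := by linarith
  have hns : (n / s : ℝ) = ε * x := by rw [hxdef]; field_simp
  -- Both `ε ≤ 2` and `x ≥ 2` enter here: the constant is swallowed by `x ^ 3 ≥ 8`.
  have h8 : exp 1 * (n / s) ≤ x ^ 4 := by
    have h1 : exp 1 ≤ 3 := by linarith [exp_one_lt_d9]
    have h3 : (8 : ℝ) ≤ x ^ 3 := by
      calc (8 : ℝ) = 2 ^ 3 := by norm_num
        _ ≤ x ^ 3 := by gcongr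
    rw [hns]
    calc exp 1 * (ε * x) ≤ 3 * (2 * x) := by gcongr
      _ ≤ 8 * x := by linarith
      _ ≤ x ^ 3 * x := by gcongr
      _ = x ^ 4 := by ring
  calc (n.choose s : ℝ) ≤ (exp 1 * (n / s)) ^ s := choose_le_exp_mul_div_pow hs
    _ ≤ (x ^ 4) ^ s := by gcongr
    _ = exp (4 * s * log x) := by
      rw [← pow_mul, ← exp_log (pow_pos hx0 (4 * s)), log_pow]
      push_cast
      rfl

/-- The constant in the bound for the size of the nets. -/
noncomputable def netConst : ℝ := 20 + 4 * log (2049 / sepConst)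

theorem twenty_le_netConst : 20 ≤ netConst := by
  have h : 0 ≤ log (2049 / sepConst) := by
    refine log_nonneg ((one_le_div sepConst_pos).2 ?_)
    linarith [sepConst_le_one]
  unfold netConst
  linarith

theorem net_card_bound {n s r : ℕ} (hr : 1 ≤ r) (hrs : r ≤ s) (hsn : s ≤ n) {ε : ℝ} (h0 : 0 < ε)
    (h2 : ε ≤ 2) (hx : 2 ≤ n / (ε * s)) :
    (n.choose s : ℝ) ^ 2 * (1 + 2 / (sepConst * ε ^ 2 / 1024)) ^ (2 * (r * s)) ≤
        exp (netConst * (r * s * log (n / (ε * s)))) ∧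
      (n.choose s : ℝ) ^ 2 * 9 ^ (2 * (r * s)) ≤
        exp (netConst * (r * s * log (n / (ε * s)))) := by
  have hs : 0 < s := by omega
  have hs' : (0 : ℝ) < s := by exact_mod_cast hs
  have hr' : (1 : ℝ) ≤ r := by exact_mod_cast hr
  have hsn' : (s : ℝ) ≤ n := by exact_mod_cast hsn
  have hκ := sepConst_pos
  have hκ1 := sepConst_le_one
  have hchoose := choose_le_exp_log hs h0 h2 hx
  have hL := half_le_log hx
  set x := n / (ε * s) with hxdef
  set L := log x
  have hx0 : 0 < x := by linarith
  -- By `s ≤ n`; this lets `L` absorb the `log (1 / ε)` coming from the fine net.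
  have hxε : 1 / ε ≤ x := by
    rw [hxdef, div_le_div_iff₀ h0 (by positivity)]
    nlinarith
  have ha : 0 ≤ log (2049 / sepConst) := by linarith [twenty_le_netConst, netConst.eq_1]
  have hch : (n.choose s : ℝ) ^ 2 ≤ exp (8 * (r * s * L)) := by
    calc (n.choose s : ℝ) ^ 2 ≤ exp (4 * s * L) ^ 2 := by gcongr
      _ = exp (8 * (1 * s * L)) := by rw [← exp_nat_mul]; congr 1; push_cast; ring
      _ ≤ exp (8 * (r * s * L)) := by gcongr
  have hnet : 1 + 2 / (sepConst * ε ^ 2 / 1024) ≤ exp ((2 * log (2049 / sepConst) + 2) * L) := by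
    calc 1 + 2 / (sepConst * ε ^ 2 / 1024) = 1 + 2048 / sepConst * (1 / ε) ^ 2 := by
          field_simp; norm_num
      _ ≤ 1 / sepConst * x ^ 2 + 2048 / sepConst * x ^ 2 := by
          have h1 : 1 ≤ 1 / sepConst := (one_le_div hκ).2 hκ1
          have h2 : 1 ≤ x ^ 2 := one_le_pow₀ (by linarith)
          gcongr
          exact one_le_mul_of_one_le_of_one_le h1 h2
      _ = exp (log (2049 / sepConst) + 2 * L) := by
          rw [exp_add, exp_log (by positivity), two_mul, exp_add, exp_log hx0]; ring
      _ ≤ exp ((2 * log (2049 / sepConst) + 2) * L) := by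
          gcongr; nlinarith
  have hnine : (9 : ℝ) ≤ exp (6 * L) := by
    calc (9 : ℝ) ≤ 2 ^ 6 := by norm_num
      _ ≤ x ^ 6 := by gcongr
      _ = exp (6 * L) := by
        rw [← exp_log (pow_pos hx0 6), log_pow]; norm_num; rfl
  have hD : netConst = 20 + 4 * log (2049 / sepConst) := rfl
  have hpos : 0 ≤ r * s * L := by positivity
  constructor
  · calc _ ≤ exp (8 * (r * s * L)) *
          exp ((2 * log (2049 / sepConst) + 2) * L) ^ (2 * (r * s)) := by gcongr
      _ = exp ((12 + 4 * log (2049 / sepConst)) * (r * s * L)) := by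
          rw [← exp_nat_mul, ← exp_add]; congr 1; push_cast; ring
      _ ≤ _ := by rw [hD]; gcongr; norm_num
  · calc _ ≤ exp (8 * (r * s * L)) * exp (6 * L) ^ (2 * (r * s)) := by gcongr
      _ = exp (20 * (r * s * L)) := by
          rw [← exp_nat_mul, ← exp_add]; congr 1; push_cast; ring
      _ ≤ _ := by gcongr; exact twenty_le_netConst

/-- The assumption makes `netConst * T` at most `sepConst * ε * m / 40`, so both exponents are at
most `-(sepConst * ε * m / 20)`. Half of this rate is given up to make each term at most half of the
right-hand side, which works because `netConst * T ≥ 10`. -/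
theorem failure_bound {ε T m : ℝ} (h0 : 0 < ε) (h2 : ε ≤ 2) (hm : 0 ≤ m) (hT : 1 / 2 ≤ T)
    (h : 40 * netConst / sepConst * T ≤ ε * m) :
    exp (netConst * T) ^ 2 * exp (-(sepConst * ε * m / 10)) + exp (netConst * T) * exp (-m) ≤
      exp (-(sepConst / 40 * ε * m)) := by
  have hκ := sepConst_pos
  have hκ1 := sepConst_le_one
  have hD := twenty_le_netConst
  have h' : 40 * (netConst * T) ≤ sepConst * ε * m := by
    rw [div_mul_eq_mul_div, div_le_iff₀ hκ] at h
    linarith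
  have hDT : 10 ≤ netConst * T := by nlinarith
  have hm2 : sepConst * ε * m ≤ 2 * m := by
    have : sepConst * ε ≤ 2 := by nlinarith
    gcongr
  have key : ∀ t, t ≤ -(sepConst * ε * m / 20) →
      exp t ≤ exp (-(sepConst / 40 * ε * m)) / 2 := fun t ht => by
    rw [le_div_iff₀ two_pos]
    calc exp t * 2 ≤ exp t * exp 1 := by gcongr; linarith [exp_one_gt_d9]
      _ = exp (t + 1) := (exp_add _ _).symm
      _ ≤ _ := by gcongr; linarith
  have e1 : exp (netConst * T) ^ 2 * exp (-(sepConst * ε * m / 10)) =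
      exp (2 * (netConst * T) - sepConst * ε * m / 10) := by
    rw [← exp_nat_mul, ← exp_add]; norm_num [sub_eq_add_neg]
  have k1 := key (2 * (netConst * T) - sepConst * ε * m / 10) (by linarith)
  have k2 := key (netConst * T + -m) (by linarith)
  rw [e1, ← exp_add]
  linarith

/-! ### Uniform tessellation and consistency width -/

theorem norm_sub_le_two {n s r : ℕ} {X X' : Matrix (Fin n) (Fin n) ℝ}
    (hX : X ∈ unitBisparseLowRank n s r) (hX' : X' ∈ unitBisparseLowRank n s r) :
    ‖X - X'‖ ≤ 2 := by
  have h1 : ‖X‖ = 1 := hX.2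
  have h2 : ‖X'‖ = 1 := hX'.2
  linarith [norm_sub_le X X']

theorem exists_event_uniform_tessellation {n s r m : ℕ} (hr : 1 ≤ r) (hrs : r ≤ s) (hsn : s ≤ n)
    {ε : ℝ} (h0 : 0 < ε) (hx : 2 * (ε * s) ≤ n)
    (hm : 40 * netConst / sepConst / ε * (r * s) * log (n / (ε * s)) ≤ m)
    {Ω : Type*} [MeasurableSpace Ω] {P : Measure Ω} [IsProbabilityMeasure P]
    {A : Fin m → Ω → Matrix (Fin n) (Fin n) ℝ} (hA : IsGaussianFamily P A) :
    ∃ E : Set Ω, MeasurableSet E ∧ 1 - exp (-(sepConst / 40 * ε * m)) ≤ P.real E ∧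
      ∀ ω ∈ E, ∀ X ∈ unitBisparseLowRank n s r, ∀ X' ∈ unitBisparseLowRank n s r,
        oneBit (measurementMap fun i => A i ω) X = oneBit (measurementMap fun i => A i ω) X' →
          ‖X - X'‖ ≤ ε := by
  rcases le_or_gt ε 2 with h2 | h2
  swap
  · refine ⟨Set.univ, MeasurableSet.univ, ?_, fun ω _ X hX X' hX' _ =>
      (norm_sub_le_two hX hX').trans h2.le⟩
    rw [probReal_univ]
    linarith [exp_pos (-(sepConst / 40 * ε * m))]
  have hκ := sepConst_pos
  have hD := twenty_le_netConst
  have hs' : (1 : ℝ) ≤ s := by exact_mod_cast hr.trans hrs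
  have hr' : (1 : ℝ) ≤ r := by exact_mod_cast hr
  have hx' : 2 ≤ n / (ε * s) := by rwa [le_div_iff₀ (by positivity)]
  have hL := half_le_log hx'
  have hT : 1 / 2 ≤ r * s * log (n / (ε * s)) := by
    have : (1 : ℝ) ≤ r * s := one_le_mul_of_one_le_of_one_le hr' hs'
    nlinarith
  have hmε : 40 * netConst / sepConst * (r * s * log (n / (ε * s))) ≤ ε * m := by
    have := mul_le_mul_of_nonneg_left hm h0.le
    refine le_trans (le_of_eq ?_) this
    field_simp
  -- The logarithm is at least `1 / 2`, so the lower bound on `m` excludes `m = 0`.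
  have hm0 : 0 < m := by
    have h1 : 0 < ε * m := lt_of_lt_of_le (by positivity) hmε
    exact_mod_cast pos_of_mul_pos_right h1 h0.le
  have hρ : 0 < sepConst * ε ^ 2 / 1024 := by positivity
  obtain ⟨N, R, hnet, hN, hR⟩ := exists_isControlledNet n s r hρ
  obtain ⟨E, hE, hPE, hsep⟩ := exists_event_of_isControlledNet hm0 h0 h2 hnet hA
  obtain ⟨b1, b2⟩ := net_card_bound hr hrs hsn h0 h2 hx'
  refine ⟨E, hE, le_trans (sub_le_sub_left ?_ 1) hPE, hsep⟩
  refine le_trans ?_ (failure_bound h0 h2 m.cast_nonneg hT hmε)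
  gcongr
  · exact hN.trans b1
  · exact hR.trans b2

theorem consistencyWidth_le {n s r m : ℕ} (𝒜 : Matrix (Fin n) (Fin n) ℝ →ₗ[ℝ] (Fin m → ℝ)) {δ : ℝ}
    (h : ∀ X ∈ unitBisparseLowRank n s r, ∀ X' ∈ unitBisparseLowRank n s r,
      oneBit 𝒜 X = oneBit 𝒜 X' → ‖X - X'‖ ≤ δ) :
    consistencyWidth m (unitBisparseLowRank n s r) ≤ ENNReal.ofReal δ :=
  iInf_le_of_le 𝒜 <| iSup₂_le fun X hX => iSup₂_le fun X' hX' => iSup_le fun hXX' =>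
    ENNReal.ofReal_le_ofReal (h X hX X' hX' hXX')

theorem consistencyWidth_unitBisparseLowRank_le {n s r m : ℕ} (hr : 1 ≤ r) (hrs : r ≤ s)
    (hsn : s ≤ n) (hnm : 2 * (r * s) ≤ n * m) :
    consistencyWidth m (unitBisparseLowRank n s r) ≤
      ENNReal.ofReal (4 * (40 * netConst / sepConst + 2) * ((r * s : ℝ) / m) *
        log ((n * m : ℝ) / (r * s))) := by
  have hκ := sepConst_pos
  have hD := twenty_le_netConst
  have hs' : (1 : ℝ) ≤ s := by exact_mod_cast hr.trans hrs
  have hr' : (1 : ℝ) ≤ r := by exact_mod_cast hr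
  have hsn' : (s : ℝ) ≤ n := by exact_mod_cast hsn
  have hm0 : 0 < m := by
    have : 0 < r * s := Nat.mul_pos hr (hr.trans hrs)
    exact Nat.pos_of_ne_zero fun h => by rw [h] at hnm; omega
  have hm' : (0 : ℝ) < m := by exact_mod_cast hm0
  set C := 40 * netConst / sepConst with hC
  have hC0 : 0 < C := by positivity
  have hy : 2 ≤ (n * m : ℝ) / (r * s) := by
    rw [le_div_iff₀ (by positivity)]
    exact_mod_cast hnm
  have hL := half_le_log hy
  set L := log ((n * m : ℝ) / (r * s)) with hLdef
  set ε := (C + 2) * ((r * s : ℝ) / m) * L with hε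
  have h0 : 0 < ε := by positivity
  have hε4 : 4 * (C + 2) * ((r * s : ℝ) / m) * L = 4 * ε := by rw [hε]; ring
  rw [hε4]
  rcases le_or_gt (2 * (ε * s)) n with hx | hx
  -- The choice of `ε` gives `n / (ε s) = (n m / (r s)) / ((C + 2) L s)`, and the last divisor is at
  -- least 1.
  · have hle : log (n / (ε * s)) ≤ L := by
      have hn0 : (0 : ℝ) < n := by linarith
      refine log_le_log (by positivity) ?_
      rw [div_le_div_iff₀ (by positivity) (by positivity)]
      have e : (n * m : ℝ) * (ε * s) = n * (r * s) * ((C + 2) * L * s) := by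
        rw [hε]; field_simp
      rw [e]
      refine le_mul_of_one_le_right (by positivity) ?_
      have : 1 ≤ (C + 2) * L := by nlinarith
      exact one_le_mul_of_one_le_of_one_le this hs'
    have hm : C / ε * (r * s) * log (n / (ε * s)) ≤ m := by
      calc C / ε * (r * s) * log (n / (ε * s)) ≤ C / ε * (r * s) * L := by gcongr
        _ = C / (C + 2) * m := by rw [hε]; field_simp
        _ ≤ 1 * m := by gcongr; rw [div_le_one (by positivity)]; linarith
        _ = m := one_mul _
    obtain ⟨E, -, hPE, hsep⟩ := exists_event_uniform_tessellation hr hrs hsn h0 hx hm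
      (exists_isGaussianFamily n m)
    have hEpos : E.Nonempty := by
      by_contra hne
      rw [Set.not_nonempty_iff_eq_empty.1 hne, measureReal_empty] at hPE
      have : exp (-(sepConst / 40 * ε * m)) < 1 := by
        rw [← exp_zero]
        exact exp_lt_exp.2 (neg_lt_zero.2 (by positivity))
      linarith
    obtain ⟨ω, hω⟩ := hEpos
    exact consistencyWidth_le _ fun X hX X' hX' h => (hsep ω hω X hX X' hX' h).trans (by linarith)
  -- Here `ε > 1 / 2` because `s ≤ n`, so `4 * ε` exceeds the diameter bound 2 and any map will do.
  -- This case is the source of the factor 4.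
  · refine consistencyWidth_le 0 fun X hX X' hX' _ => (norm_sub_le_two hX hX').trans ?_
    have : 1 * (s : ℝ) < (2 * ε) * s := by linarith
    have := lt_of_mul_lt_mul_right this (by linarith)
    linarith

end OneBit

theorem mainTheorem1 :
    (∃ C c : ℝ, 0 < C ∧ 0 < c ∧
      ∀ (n s r m : ℕ), 1 ≤ r → r ≤ s → s ≤ n →
      ∀ ε : ℝ, 0 < ε → 2 * (ε * s) ≤ n →
        C / ε * (r * s) * Real.log (n / (ε * s)) ≤ m →
      ∀ (Ω : Type*) [MeasurableSpace Ω] (P : MeasureTheory.Measure Ω)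
        [MeasureTheory.IsProbabilityMeasure P]
        (A : Fin m → Ω → Matrix (Fin n) (Fin n) ℝ), OneBit.IsGaussianFamily P A →
        ∃ E : Set Ω, MeasurableSet E ∧ 1 - Real.exp (-(c * ε * m)) ≤ P.real E ∧
          ∀ ω ∈ E, ∀ X ∈ OneBit.unitBisparseLowRank n s r,
            ∀ X' ∈ OneBit.unitBisparseLowRank n s r,
              OneBit.oneBit (OneBit.measurementMap fun i => A i ω) X =
                  OneBit.oneBit (OneBit.measurementMap fun i => A i ω) X' →
                ‖X - X'‖ ≤ ε) ∧
    (∃ C : ℝ, 0 < C ∧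
      ∀ (n s r m : ℕ), 1 ≤ r → r ≤ s → s ≤ n → 2 * (r * s) ≤ n * m →
        OneBit.consistencyWidth m (OneBit.unitBisparseLowRank n s r) ≤
          ENNReal.ofReal
            (C * ((r * s : ℝ) / m) * Real.log ((n * m : ℝ) / (r * s)))) := by
  have hκ := OneBit.sepConst_pos
  have hD := OneBit.twenty_le_netConst
  refine ⟨⟨40 * OneBit.netConst / OneBit.sepConst, OneBit.sepConst / 40, by positivity,
    by positivity, ?_⟩, 4 * (40 * OneBit.netConst / OneBit.sepConst + 2), by positivity, ?_⟩
  · intro n s r m hr hrs hsn ε h0 hx hm Ω _ P _ A hA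
    exact OneBit.exists_event_uniform_tessellation hr hrs hsn h0 hx hm hA
  · intro n s r m hr hrs hsn hnm
    exact OneBit.consistencyWidth_unitBisparseLowRank_le hr hrs hsn hnm
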